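/- Let $N\ge 1$, let $P=(p_{ij})$ be a real $N\times N$ matrix with $p_{ij}\ge 0$ for all $i,j$, and assume that there is a vector $V$ with $v_i>0$ for all $i$ and $V^TP=V^T$. Let $e=\frac1N(1,\dots,1)^T\in\mathbb R^N$ and $B=Pe-e$. Let $J_i$ be the $N\times N$ matrix whose only non-zero entry is a $1$ at position $(i,i)$, and let $P_i=I-J_i+PJ_i$. For a sequence of nodes $i_1,i_2,\dots\in\{1,\dots,N\}$ the D-iteration is $$F_0=B,\quad H_0=0,\qquad F_n=P_{i_n}F_{n-1},\quad H_n=H_{n-1}+J_{i_n}F_{n-1}\qquad(n\ge 1).$$ Consider either of the following two ways of diffusing only negative fluids along a fair sequence. (a) The D-iteration as above, along any sequence $(i_n)$ such that $(F_{n-1})_{i_n}\le 0$ for all $n\ge1$ and such that every node $i$ with $(F_n)_i<0$ for some $n\ge 0$ occurs infinitely often in $(i_n)$. (b) The iteration with candidates, along any sequence $(i_n)$ in which every node of $\{1,\dots,N\}$ occurs infinitely often: at step $n$ the node $i_n$ is diffused, by the formulas above, if $(F_{n-1})_{i_n}<0$; otherwise $F_n=F_{n-1}$ and $H_n=H_{n-1}$.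 Then there is a vector $H_\infty\in\mathbb R^N$, the same for all these sequences in (a) and in (b), such that $H_n\to H_\infty$. The vector $X=H_\infty+e$ is a right eigenvector of $P$ for the eigenvalue $1$ (that is, $X\ne 0$ and $PX=X$), and for every strongly connected component $C$ of the directed graph of $P$ (nodes $1,\dots,N$, with an edge between $j$ and $i$, directed from $j$ to $i$, when $p_{ij}>0$) for which the submatrix of $P$ with rows and columns in $C$ has spectral radius one, $\max_{i\in C}X_i=\frac1N$. Moreover, $X$ is the only right eigenvector of $P$ for the eigenvalue $1$ with these maxima. -/

import Mathlib

open Filter Topology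

namespace DIter

noncomputable section

variable {N : ℕ}

/-- The vector `e = (1/N, …, 1/N)ᵀ`. -/
def unitVec (N : ℕ) : Fin N → ℝ := fun _ => 1 / (N : ℝ)

/-- `J_i`: the only non-zero entry is a `1` at position `(i, i)`. -/
def projMat (i : Fin N) : Matrix (Fin N) (Fin N) ℝ := Matrix.single i i 1

/-- The diffusion operator `P_i = I - J_i + P J_i`. -/
def diffOp (P : Matrix (Fin N) (Fin N) ℝ) (i : Fin N) : Matrix (Fin N) (Fin N) ℝ :=
  1 - projMat i + P * projMat i

/-- The fluid `F_n` of the D-iteration for `(P, B)` along the sequence `i₁, i₂, …`, where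
`ι n` stands for `i_{n+1}`: `F₀ = B` and `F_{n+1} = P_{i_{n+1}} F_n`. -/
def fluid (P : Matrix (Fin N) (Fin N) ℝ) (B : Fin N → ℝ) (ι : ℕ → Fin N) : ℕ → (Fin N → ℝ)
  | 0 => B
  | n + 1 => (diffOp P (ι n)).mulVec (fluid P B ι n)

/-- The history `H_n`: `H₀ = 0` and `H_{n+1} = H_n + J_{i_{n+1}} F_n`. -/
def history (P : Matrix (Fin N) (Fin N) ℝ) (B : Fin N → ℝ) (ι : ℕ → Fin N) : ℕ → (Fin N → ℝ)
  | 0 => 0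
  | n + 1 => history P B ι n + (projMat (ι n)).mulVec (fluid P B ι n)

/-- Every node occurs infinitely often in the sequence. -/
def IsFair (ι : ℕ → Fin N) : Prop := ∀ i, {n | ι n = i}.Infinite

/-- A fair sequence of negative diffusions: no diffused node carries positive fluid at the moment
when it is diffused, and every node that carries negative fluid at some time is diffused
infinitely often. -/
def IsNegFair (P : Matrix (Fin N) (Fin N) ℝ) (B : Fin N → ℝ) (ι : ℕ → Fin N) : Prop :=
  (∀ n, fluid P B ι n (ι n) ≤ 0) ∧
    ∀ i, (∃ n, fluid P B ι n i < 0) → {n | ι n = i}.Infinite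

/-- The fluid when `i₁, i₂, …` is a sequence of candidates (`ι n` stands for `i_{n+1}`), a
candidate being diffused only if its fluid is negative at that moment. -/
def testedFluid (P : Matrix (Fin N) (Fin N) ℝ) (B : Fin N → ℝ) (ι : ℕ → Fin N) :
    ℕ → (Fin N → ℝ)
  | 0 => B
  | n + 1 =>
      if testedFluid P B ι n (ι n) < 0 then (diffOp P (ι n)).mulVec (testedFluid P B ι n)
      else testedFluid P B ι n

/-- The history that belongs to `testedFluid`. -/
def testedHistory (P : Matrix (Fin N) (Fin N) ℝ) (B : Fin N → ℝ) (ι : ℕ → Fin N) :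
    ℕ → (Fin N → ℝ)
  | 0 => 0
  | n + 1 =>
      if testedFluid P B ι n (ι n) < 0 then
        testedHistory P B ι n + (projMat (ι n)).mulVec (testedFluid P B ι n)
      else testedHistory P B ι n

/-- The strongly connected components of the directed graph of `P`, as sets of nodes.
(`Matrix.toQuiver` has an edge `i ⟶ j` when `0 < P i j`; reversing all edges would not change
the components.) -/
def sccs (P : Matrix (Fin N) (Fin N) ℝ) : Set (Set (Fin N)) :=
  (@Quiver.stronglyConnectedSetoid (Fin N) P.toQuiver).classes

open Classical in
/-- The spectral radius (over `ℂ`) of the restriction of `P` to the rows and columns in `C`. -/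
def restrictedRadius (P : Matrix (Fin N) (Fin N) ℝ) (C : Set (Fin N)) : ENNReal :=
  spectralRadius ℂ
    ((P.submatrix (fun i : C => (i : Fin N)) (fun j : C => (j : Fin N))).map
      (fun x : ℝ => (x : ℂ)))

/-- `X` is a right eigenvector of `P` for the eigenvalue `1`, and on each strongly connected
component of spectral radius one its maximum is `1/N`. -/
def IsNormalizedEigenvector (P : Matrix (Fin N) (Fin N) ℝ) (X : Fin N → ℝ) : Prop :=
  X ≠ 0 ∧ P.mulVec X = X ∧
    ∀ C ∈ sccs P, restrictedRadius P C = 1 → IsGreatest (X '' C) (1 / (N : ℝ))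

end

end DIter

/-!
Put `X n = H n + e`. Then the fluid is `F n = P X n - X n`, so that the diffusion of a node `i`
with nonpositive fluid replaces the coordinate `X n i` by the smaller value `(P X n) i`. Hence
`X n` decreases and stays nonnegative, so it has a limit `X`, and fairness gives `X ≤ P X`. Pairing
with the positive left eigenvector `V` turns every inequality `y ≤ P y` into an equality
(`DIter.mulVec_eq_of_le`), so `P X = X`. A fixed vector `Y ≤ e` stays below all `X n`; therefore `X`
is the greatest fixed vector of `P` below `e` (`DIter.tendsto_of_relaxation`), whatever the
sequence was.

The positive part and the absolute value of a fixed vector are again fixed, by the same equality.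
The support of a nonnegative fixed vector is closed under following edges from `j` to `i` when
`0 < p i j`, and it only meets components that no edge leaves (`DIter.reaches_symm_of_fixed`). A
component `C` has spectral radius one iff no edge leaves it. If the radius is one, the absolute
value of a complex eigenvector of the submatrix for an eigenvalue of modulus one, extended by zero,
satisfies `y ≤ P y` and so is a fixed vector that is positive on `C` and zero outside
(`DIter.exists_fixed_of_restrictedRadius_eq_one`). Conversely, if no edge leaves `C`, then `V`
restricted to `C` is a positive left eigenvector of the submatrix
(`DIter.restrictedRadius_eq_one_of_closed`).

If the greatest fixed vector `X ≤ e` were below `1/N` on all of such a `C`, a small multiple of this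
`y` could be added to it; so its maximum on `C` is `1/N`. If `X` and `Y` are two normalized
eigenvectors and `X - Y` is positive somewhere on `C`, then its positive part is positive on all
of `C`, which contradicts the equality of the maxima; and both vanish on all other nodes.
-/

open Matrix

namespace DIter

/-! ### Nonnegative matrices with a positive left fixed vector -/

section Fixed

variable {ι : Type*} {P : Matrix ι ι ℝ} {V y : ι → ℝ}

/-- There is a directed path from `i` to `j` in `P.toQuiver`. Since `P i j` is the weight with which
`j` contributes to `(P y) i`, positivity of `y` is passed on from `j` to `i`. -/
def Reaches (P : Matrix ι ι ℝ) (i j : ι) : Prop := Nonempty (@Quiver.Path ι P.toQuiver i j)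

lemma Reaches.refl (i : ι) : Reaches P i i :=
  ⟨@Quiver.Path.nil ι P.toQuiver i⟩

lemma Reaches.trans {i j k : ι} (h : Reaches P i j) (h' : Reaches P j k) : Reaches P i k := by
  let := P.toQuiver
  exact ⟨h.some.comp h'.some⟩

lemma Reaches.of_pos {i j : ι} (h : 0 < P i j) : Reaches P i j := by
  let := P.toQuiver
  exact ⟨Quiver.Hom.toPath (show i ⟶ j from ⟨h⟩)⟩

variable [Fintype ι]

lemma mulVec_mono (hP : ∀ i j, 0 ≤ P i j) {x y : ι → ℝ} (h : x ≤ y) : P *ᵥ x ≤ P *ᵥ y :=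
  fun i => Finset.sum_le_sum fun j _ => mul_le_mul_of_nonneg_left (h j) (hP i j)

lemma mulVec_nonneg' (hP : ∀ i j, 0 ≤ P i j) (h : 0 ≤ y) : 0 ≤ P *ᵥ y := by
  simpa using mulVec_mono hP h

/-- Both sides of `y ≤ P y` have the same pairing with the positive left fixed vector `V`. -/
lemma mulVec_eq_of_le (hV : ∀ i, 0 < V i) (hVP : V ᵥ* P = V) (h : y ≤ P *ᵥ y) :
    P *ᵥ y = y := by
  have hs : V ⬝ᵥ y = V ⬝ᵥ (P *ᵥ y) := by rw [dotProduct_mulVec, hVP]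
  have := (Finset.sum_eq_sum_iff_of_le
    (fun i _ => mul_le_mul_of_nonneg_left (h i) (hV i).le)).1 hs
  ext i
  exact (mul_left_cancel₀ (hV i).ne' (this i (Finset.mem_univ i))).symm

lemma mulVec_abs_of_fixed (hP : ∀ i j, 0 ≤ P i j) (hV : ∀ i, 0 < V i) (hVP : V ᵥ* P = V)
    (hy : P *ᵥ y = y) : P *ᵥ |y| = |y| := by
  refine mulVec_eq_of_le hV hVP (abs_le'.2 ⟨?_, ?_⟩)
  · conv_lhs => rw [← hy]
    exact mulVec_mono hP (le_abs_self y)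
  · conv_lhs => rw [← hy, ← mulVec_neg]
    exact mulVec_mono hP (neg_le_abs y)

lemma mulVec_posPart_of_fixed (hP : ∀ i j, 0 ≤ P i j) (hV : ∀ i, 0 < V i) (hVP : V ᵥ* P = V)
    (hy : P *ᵥ y = y) : P *ᵥ (y ⊔ 0) = y ⊔ 0 := by
  refine mulVec_eq_of_le hV hVP (sup_le ?_ (mulVec_nonneg' hP le_sup_right))
  conv_lhs => rw [← hy]
  exact mulVec_mono hP le_sup_left

lemma pos_of_edge (hP : ∀ i j, 0 ≤ P i j) (hy : P *ᵥ y = y) (h0 : 0 ≤ y) {i j : ι}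
    (hij : 0 < P i j) (hj : 0 < y j) : 0 < y i := by
  rw [← hy]
  exact (mul_pos hij hj).trans_le
    (Finset.single_le_sum (f := fun j => P i j * y j) (fun k _ => mul_nonneg (hP i k) (h0 k))
      (Finset.mem_univ j))

lemma pos_of_reaches (hP : ∀ i j, 0 ≤ P i j) (hy : P *ᵥ y = y) (h0 : 0 ≤ y) {i j : ι}
    (h : Reaches P i j) (hj : 0 < y j) : 0 < y i := by
  let := P.toQuiver
  obtain ⟨p⟩ := h
  induction p with
  | nil => exact hj
  | cons p e ih => exact ih (pos_of_edge hP hy h0 e.down hj)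

/-- The support of a nonnegative fixed vector only meets components that no edge leaves. -/
lemma reaches_symm_of_fixed (hP : ∀ i j, 0 ≤ P i j) (hV : ∀ i, 0 < V i) (hVP : V ᵥ* P = V)
    (hy : P *ᵥ y = y) (h0 : 0 ≤ y) {i k : ι} (hi : 0 < y i) (hki : Reaches P k i) :
    Reaches P i k := by
  classical
  by_contra hik
  -- Restricting `y` to the nodes that are not reached from `k` gives again a fixed vector, whose
  -- support contains `i` but not `k`.
  let z : ι → ℝ := fun l => if Reaches P l k then 0 else y l
  have hz0 : 0 ≤ z := fun l => by
    by_cases hl : Reaches P l k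
    · simp [z, hl]
    · simpa [z, hl] using h0 l
  have hz : P *ᵥ z = z := by
    refine mulVec_eq_of_le hV hVP fun l => ?_
    by_cases hl : Reaches P l k
    · simpa [z, hl] using mulVec_nonneg' hP hz0 l
    · have : (P *ᵥ z) l = (P *ᵥ y) l := by
        refine Finset.sum_congr rfl fun j _ => ?_
        by_cases hj : Reaches P j k
        · have : P l j = 0 := by
            by_contra hne
            exact hl ((Reaches.of_pos (lt_of_le_of_ne (hP l j) (Ne.symm hne))).trans hj)
          simp [this]
        · simp [z, hj]
      rw [this, hy]
      simp [z, hl]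
  have hzk := pos_of_reaches hP hz hz0 hki (by simpa [z, hik] using hi)
  simp [z, Reaches.refl] at hzk

end Fixed

/-! ### Spectral radius of nonnegative matrices -/

section Radius

variable {ι : Type*} [Fintype ι] {A : Matrix ι ι ℝ}

lemma exists_eigenvector_of_mem_spectrum [DecidableEq ι] {M : Matrix ι ι ℂ} {μ : ℂ}
    (h : μ ∈ spectrum ℂ M) :
    ∃ x ≠ 0, M *ᵥ x = μ • x := by
  rw [spectrum.mem_iff, Matrix.isUnit_iff_isUnit_det, isUnit_iff_ne_zero, not_not] at h
  obtain ⟨x, hx, hx'⟩ := Matrix.exists_mulVec_eq_zero_iff.2 h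
  refine ⟨x, hx, ?_⟩
  rw [sub_mulVec, sub_eq_zero, Algebra.algebraMap_eq_smul_one, smul_mulVec, one_mulVec] at hx'
  exact hx'.symm

lemma norm_mul_abs_le (hA : ∀ i j, 0 ≤ A i j) {μ : ℂ} {x : ι → ℂ}
    (hx : A.map (fun r : ℝ => (r : ℂ)) *ᵥ x = μ • x) (i : ι) :
    ‖μ‖ * ‖x i‖ ≤ (A *ᵥ fun j => ‖x j‖) i := by
  have := congrFun hx i
  rw [Pi.smul_apply, smul_eq_mul] at this
  rw [← norm_mul, ← this]
  refine (norm_sum_le _ _).trans (Finset.sum_le_sum fun j _ => ?_)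
  simp [abs_of_nonneg (hA i j)]

lemma spectralRadius_le_one [DecidableEq ι] (hA : ∀ i j, 0 ≤ A i j) {v : ι → ℝ} (hv : ∀ i, 0 < v i)
    (hvA : v ᵥ* A ≤ v) :
    spectralRadius ℂ (A.map fun r : ℝ => (r : ℂ)) ≤ 1 := by
  refine iSup₂_le fun μ hμ => ?_
  obtain ⟨x, hx0, hx⟩ := exists_eigenvector_of_mem_spectrum hμ
  -- Compare the norms of both sides of `A x = μ x`, weighted by `v`.
  have hpos : 0 < v ⬝ᵥ fun j => ‖x j‖ := by
    obtain ⟨i, hi⟩ := Function.ne_iff.1 hx0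
    exact Finset.sum_pos' (fun j _ => mul_nonneg (hv j).le (norm_nonneg _))
      ⟨i, Finset.mem_univ i, mul_pos (hv i) (norm_pos_iff.2 hi)⟩
  have h1 : ‖μ‖ * (v ⬝ᵥ fun j => ‖x j‖) ≤ 1 * (v ⬝ᵥ fun j => ‖x j‖) := by
    calc ‖μ‖ * (v ⬝ᵥ fun j => ‖x j‖) = ∑ i, v i * (‖μ‖ * ‖x i‖) := by
          rw [dotProduct, Finset.mul_sum]
          exact Finset.sum_congr rfl fun i _ => by ring
      _ ≤ v ⬝ᵥ (A *ᵥ fun j => ‖x j‖) :=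
          Finset.sum_le_sum fun i _ => mul_le_mul_of_nonneg_left (norm_mul_abs_le hA hx i) (hv i).le
      _ = (v ᵥ* A) ⬝ᵥ fun j => ‖x j‖ := dotProduct_mulVec _ _ _
      _ ≤ v ⬝ᵥ fun j => ‖x j‖ :=
          Finset.sum_le_sum fun i _ => mul_le_mul_of_nonneg_right (hvA i) (norm_nonneg _)
      _ = _ := (one_mul _).symm
  have h2 : ‖μ‖ ≤ 1 := le_of_mul_le_mul_right h1 hpos
  exact_mod_cast h2

lemma one_le_spectralRadius [DecidableEq ι] {v : ι → ℝ} (hv : v ≠ 0) (hvA : v ᵥ* A = v) :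
    1 ≤ spectralRadius ℂ (A.map fun r : ℝ => (r : ℂ)) := by
  have hmem : (1 : ℂ) ∈ spectrum ℂ (A.map fun r : ℝ => (r : ℂ)) := by
    rw [spectrum.mem_iff, Matrix.isUnit_iff_isUnit_det, isUnit_iff_ne_zero, not_not,
      ← Matrix.exists_vecMul_eq_zero_iff]
    refine ⟨fun i => (v i : ℂ), fun h => hv ?_, ?_⟩
    · ext i
      exact Complex.ofReal_eq_zero.1 (congrFun h i)
    · rw [map_one, vecMul_sub, vecMul_one, sub_eq_zero]
      ext j
      have := congrFun hvA j
      simp only [vecMul, dotProduct, map_apply] at this ⊢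
      exact_mod_cast this.symm
  exact le_trans (by simp) (le_iSup₂ (f := fun k (_ : k ∈ spectrum ℂ _) => (‖k‖₊ : ENNReal)) 1 hmem)

/-- The absolute value of an eigenvector for an eigenvalue of modulus one. -/
lemma exists_le_mulVec_of_spectralRadius_eq_one [DecidableEq ι]
    (hA : ∀ i j, 0 ≤ A i j)
    (h : spectralRadius ℂ (A.map fun r : ℝ => (r : ℂ)) = 1) :
    ∃ y : ι → ℝ, 0 ≤ y ∧ y ≠ 0 ∧ y ≤ A *ᵥ y := by
  have hne : (spectrum ℂ (A.map fun r : ℝ => (r : ℂ))).Nonempty := by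
    by_contra hemp
    rw [Set.not_nonempty_iff_eq_empty] at hemp
    simp [spectralRadius, hemp] at h
  obtain ⟨μ, hμ, hmax⟩ := Set.exists_max_image _ (fun k : ℂ => (‖k‖₊ : ENNReal))
    (Matrix.finite_spectrum (A.map fun r : ℝ => (r : ℂ))) hne
  have h1 : 1 ≤ ‖μ‖ := by
    have : (1 : ENNReal) ≤ ‖μ‖₊ := h ▸ iSup₂_le hmax
    exact_mod_cast this
  obtain ⟨x, hx0, hx⟩ := exists_eigenvector_of_mem_spectrum hμ
  refine ⟨fun i => ‖x i‖, fun i => norm_nonneg _, fun h0 => hx0 ?_, fun i => ?_⟩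
  · ext i
    exact norm_eq_zero.1 (congrFun h0 i)
  · exact (le_mul_of_one_le_left (norm_nonneg _) h1).trans (norm_mul_abs_le hA hx i)

end Radius

/-! ### Components of spectral radius one -/

section Components

variable {N : ℕ} {P : Matrix (Fin N) (Fin N) ℝ} {V : Fin N → ℝ} {C : Set (Fin N)}

lemma reaches_of_mem_sccs (hC : C ∈ sccs P) {i j : Fin N} (hi : i ∈ C) (hj : j ∈ C) :
    Reaches P i j := by
  obtain ⟨k, rfl⟩ := hC
  exact Reaches.trans hi.1 hj.2

lemma nonempty_of_mem_sccs (hC : C ∈ sccs P) : C.Nonempty := by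
  obtain ⟨k, rfl⟩ := hC
  exact ⟨k, Reaches.refl k, Reaches.refl k⟩

lemma sum_coe_eq_sum {ι : Type*} [Fintype ι] {C : Set ι} [Fintype C] {f : ι → ℝ}
    (h : ∀ i ∉ C, f i = 0) : ∑ i : C, f i = ∑ i, f i := by
  classical
  rw [← Finset.sum_subset (Finset.subset_univ C.toFinset) fun i _ hi => h i (by simpa using hi)]
  exact (Finset.sum_subtype C.toFinset (fun i => Set.mem_toFinset) f).symm

/-- A component of spectral radius one carries a nonnegative fixed vector of the whole matrix. -/
lemma exists_fixed_of_restrictedRadius_eq_one (hP : ∀ i j, 0 ≤ P i j) (hV : ∀ i, 0 < V i)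
    (hVP : V ᵥ* P = V) (hC : C ∈ sccs P) (hr : restrictedRadius P C = 1) :
    ∃ y : Fin N → ℝ, P *ᵥ y = y ∧ (∀ i ∈ C, 0 < y i) ∧ ∀ i ∉ C, y i = 0 := by
  classical
  obtain ⟨w, hw0, hwne, hw⟩ := exists_le_mulVec_of_spectralRadius_eq_one
    (A := P.submatrix (fun i : C => (i : Fin N)) (fun j : C => (j : Fin N)))
    (fun i j => hP i j) (by unfold restrictedRadius at hr; convert hr)
  let y : Fin N → ℝ := fun i => if h : i ∈ C then w ⟨i, h⟩ else 0
  have hy0 : 0 ≤ y := fun i => by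
    by_cases h : i ∈ C
    · simpa [y, h] using hw0 ⟨i, h⟩
    · simp [y, h]
  have hyout : ∀ i ∉ C, y i = 0 := fun i h => by simp [y, h]
  have hy : P *ᵥ y = y := by
    refine mulVec_eq_of_le hV hVP fun i => ?_
    by_cases h : i ∈ C
    · have e1 : (P *ᵥ y) i = ∑ j : C, P i j * w j := by
        rw [mulVec, dotProduct, ← sum_coe_eq_sum fun j hj => by rw [hyout j hj, mul_zero]]
        exact Finset.sum_congr rfl fun j _ => by simp [y]
      rw [e1]
      simp only [y, h, dite_true]
      exact hw ⟨i, h⟩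
    · simpa [y, h] using mulVec_nonneg' hP hy0 i
  refine ⟨y, hy, fun i hi => ?_, hyout⟩
  obtain ⟨j, hj⟩ := Function.ne_iff.1 hwne
  refine pos_of_reaches hP hy hy0 (reaches_of_mem_sccs hC hi j.2) ?_
  simpa [y] using lt_of_le_of_ne (hw0 j) (Ne.symm hj)

/-- The restriction of `V` to a set of nodes that no edge leaves is a left fixed vector of the
submatrix. -/
lemma restrictedRadius_eq_one_of_closed (hP : ∀ i j, 0 ≤ P i j) (hV : ∀ i, 0 < V i)
    (hVP : V ᵥ* P = V) (hne : C.Nonempty) (hcl : ∀ i j, j ∈ C → 0 < P i j → i ∈ C) :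
    restrictedRadius P C = 1 := by
  classical
  have hv : (fun i : C => V i) ᵥ*
      (P.submatrix (fun i : C => (i : Fin N)) (fun j : C => (j : Fin N))) = fun i : C => V i := by
    ext j
    refine Eq.trans ?_ (congrFun hVP j)
    refine sum_coe_eq_sum (C := C) (f := fun i => V i * P i j) fun i hi => ?_
    rw [(hP i j).antisymm' (not_lt.1 fun h => hi (hcl i j j.2 h)), mul_zero]
  have hle := spectralRadius_le_one
    (A := P.submatrix (fun i : C => (i : Fin N)) (fun j : C => (j : Fin N)))
    (fun i j => hP i j) (fun i : C => hV i) hv.le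
  obtain ⟨i, hi⟩ := hne
  have hge := one_le_spectralRadius
    (fun h => (hV i).ne' (congrFun h ⟨i, hi⟩)) hv
  unfold restrictedRadius
  convert le_antisymm hle hge

/-- If `X` were below `1 / N` on a whole component of spectral radius one, a small multiple of the
fixed vector carried by the component could be added to it. -/
lemma isNormalizedEigenvector_of_isGreatest (hN : 0 < N) (hP : ∀ i j, 0 ≤ P i j)
    (hV : ∀ i, 0 < V i) (hVP : V ᵥ* P = V) {X : Fin N → ℝ}
    (hX : IsGreatest {Y | P *ᵥ Y = Y ∧ Y ≤ unitVec N} X) : IsNormalizedEigenvector P X := by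
  have hN' : (0 : ℝ) < 1 / N := by positivity
  -- Small positive multiples of any vector are below a given positive constant.
  have hsmall : ∀ y : Fin N → ℝ, ∀ ε : ℝ, 0 < ε → ∃ δ > 0, ∀ i, δ * y i ≤ ε := by
    intro y ε hε
    refine ⟨ε / (1 + ∑ i, |y i|), by positivity, fun i => ?_⟩
    have hs : |y i| ≤ ∑ i, |y i| :=
      Finset.single_le_sum (f := fun i => |y i|) (fun j _ => abs_nonneg _) (Finset.mem_univ i)
    rw [div_mul_eq_mul_div, div_le_iff₀ (by positivity)]
    exact mul_le_mul_of_nonneg_left (by linarith [le_abs_self (y i)]) hε.le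
  refine ⟨?_, hX.1.1, fun C hC hr => ⟨?_, ?_⟩⟩
  · -- The eigenvalue `1` also has a right eigenvector; a multiple of its absolute value is below `e`.
    rintro rfl
    obtain ⟨x, hx0, hx⟩ : ∃ x ≠ 0, (1 - P) *ᵥ x = 0 := by
      rw [Matrix.exists_mulVec_eq_zero_iff, ← Matrix.exists_vecMul_eq_zero_iff]
      exact ⟨V, fun h => (hV ⟨0, hN⟩).ne' (congrFun h _), by
        rw [vecMul_sub, vecMul_one, hVP, sub_self]⟩
    rw [sub_mulVec, one_mulVec, sub_eq_zero] at hx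
    have hfix := mulVec_abs_of_fixed hP hV hVP hx.symm
    obtain ⟨δ, hδ, hle⟩ := hsmall |x| _ hN'
    have := hX.2 (show δ • |x| ∈ _ from ⟨by rw [mulVec_smul, hfix], hle⟩)
    obtain ⟨i, hi⟩ := Function.ne_iff.1 hx0
    exact (mul_pos hδ (abs_pos.2 hi)).not_ge (this i)
  · by_contra hmem
    have hlt : ∀ i ∈ C, X i < 1 / N := fun i hi =>
      lt_of_le_of_ne (hX.1.2 i) fun h => hmem ⟨i, hi, h⟩
    obtain ⟨y, hy, hypos, hyout⟩ := exists_fixed_of_restrictedRadius_eq_one hP hV hVP hC hr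
    obtain ⟨m, hm, hmax⟩ := Set.exists_max_image C X C.toFinite (nonempty_of_mem_sccs hC)
    obtain ⟨δ, hδ, hle⟩ := hsmall y (1 / N - X m) (sub_pos.2 (hlt m hm))
    have := hX.2 (show X + δ • y ∈ _ from ⟨by rw [mulVec_add, mulVec_smul, hX.1.1, hy], fun i => by
      by_cases hi : i ∈ C
      · have := hmax i hi
        have := hle i
        simp only [Pi.add_apply, Pi.smul_apply, smul_eq_mul, unitVec]
        linarith
      · simpa [hyout i hi] using hX.1.2 i⟩) m
    simp only [Pi.add_apply, Pi.smul_apply, smul_eq_mul] at this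
    linarith [mul_pos hδ (hypos m hm)]
  · rintro _ ⟨i, -, rfl⟩
    exact hX.1.2 i

/-- Any two normalized eigenvectors are comparable, in both directions, which gives uniqueness. -/
lemma IsNormalizedEigenvector.le (hP : ∀ i j, 0 ≤ P i j) (hV : ∀ i, 0 < V i) (hVP : V ᵥ* P = V)
    {X Y : Fin N → ℝ} (hX : IsNormalizedEigenvector P X) (hY : IsNormalizedEigenvector P Y) :
    X ≤ Y := by
  intro i
  by_contra! hi
  have hD : P *ᵥ (X - Y) = X - Y := by rw [mulVec_sub, hX.2.1, hY.2.1]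
  have hD' := mulVec_posPart_of_fixed hP hV hVP hD
  have hDi : 0 < ((X - Y) ⊔ 0) i := lt_sup_of_lt_left (sub_pos.2 hi)
  have hsymm : ∀ k, Reaches P k i → Reaches P i k := fun k =>
    reaches_symm_of_fixed hP hV hVP hD' le_sup_right hDi
  -- The component of `i` is closed, so `X` and `Y` have the same maximum on it, but `X - Y` is
  -- positive there.
  let C : Set (Fin N) := {k | Reaches P k i ∧ Reaches P i k}
  have hC : C ∈ sccs P := ⟨i, rfl⟩
  have hr : restrictedRadius P C = 1 :=
    restrictedRadius_eq_one_of_closed hP hV hVP (nonempty_of_mem_sccs hC) fun k j hj hkj =>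
      have := (Reaches.of_pos hkj).trans hj.1
      ⟨this, hsymm k this⟩
  obtain ⟨j, hj, hj'⟩ := (hY.2.2 C hC hr).1
  have hle := (hX.2.2 C hC hr).2 ⟨j, hj, rfl⟩
  have hpos : 0 < ((X - Y) ⊔ 0) j := pos_of_reaches hP hD' le_sup_right hj.1 hDi
  simp only [Pi.sup_apply, Pi.sub_apply, Pi.zero_apply, lt_sup_iff, lt_irrefl, or_false] at hpos
  linarith

end Components

/-! ### Monotone convergence of the iteration -/

section Iteration

variable {N : ℕ} {P : Matrix (Fin N) (Fin N) ℝ} {V : Fin N → ℝ}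

/-- A decreasing sequence of vectors, in each step of which every coordinate is at least the
minimum of its old value and the value of `P X` (hence `hlow`), while it is infinitely often at most
the value of `P X`, converges to the greatest fixed vector of `P` below the initial vector. -/
lemma tendsto_of_relaxation (hP : ∀ i j, 0 ≤ P i j) (hV : ∀ i, 0 < V i) (hVP : V ᵥ* P = V)
    {X : ℕ → Fin N → ℝ} (h0 : 0 ≤ X 0) (hanti : ∀ n, X (n + 1) ≤ X n)
    (hlow : ∀ n, X n ⊓ P *ᵥ X n ≤ X (n + 1))
    (hfair : ∀ i, ∃ᶠ n in atTop, X (n + 1) i ≤ (P *ᵥ X n) i) :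
    ∃ L, Tendsto X atTop (𝓝 L) ∧ IsGreatest {Y | P *ᵥ Y = Y ∧ Y ≤ X 0} L := by
  have hbelow : ∀ Y, P *ᵥ Y = Y → Y ≤ X 0 → ∀ n, Y ≤ X n := by
    intro Y hY hY0 n
    induction n with
    | zero => exact hY0
    | succ n ih =>
      refine (le_inf ih ?_).trans (hlow n)
      conv_lhs => rw [← hY]
      exact mulVec_mono hP ih
  have hmono : Antitone X := antitone_nat_of_succ_le hanti
  have hbdd := hbelow 0 (mulVec_zero P) h0
  have hlim : Tendsto X atTop (𝓝 (⨅ n, X n)) :=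
    tendsto_atTop_ciInf hmono ⟨0, by rintro _ ⟨n, rfl⟩; exact hbdd n⟩
  set L := ⨅ n, X n
  refine ⟨L, hlim, ⟨?_, hmono.le_of_tendsto hlim 0⟩, fun Y hY =>
    ge_of_tendsto' hlim (hbelow Y hY.1 hY.2)⟩
  refine mulVec_eq_of_le hV hVP fun i => ?_
  have h1 : Tendsto (fun n => X (n + 1) i) atTop (𝓝 (L i)) :=
    ((tendsto_pi_nhds.1 hlim i).comp (tendsto_add_atTop_nat 1))
  have h2 : Tendsto (fun n => (P *ᵥ X n) i) atTop (𝓝 ((P *ᵥ L) i)) :=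
    tendsto_pi_nhds.1 (((continuous_const.matrix_mulVec continuous_id).tendsto L).comp hlim) i
  exact le_of_tendsto_of_tendsto_of_frequently h1 h2 (hfair i)

lemma projMat_mulVec (i : Fin N) (f : Fin N → ℝ) : projMat i *ᵥ f = Pi.single i (f i) := by
  rw [projMat, single_mulVec, one_mul]
  rfl

lemma diffOp_mulVec_residual (i : Fin N) (x : Fin N → ℝ) :
    diffOp P i *ᵥ (P *ᵥ x - x) =
      P *ᵥ (x + projMat i *ᵥ (P *ᵥ x - x)) - (x + projMat i *ᵥ (P *ᵥ x - x)) := by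
  rw [diffOp, add_mulVec, sub_mulVec, one_mulVec, ← mulVec_mulVec, mulVec_add]
  abel

/-- The fluid is the residual `P x - x` of the vector `x = H n + e`. -/
lemma fluid_eq (e : Fin N → ℝ) (ι : ℕ → Fin N) (n : ℕ) :
    fluid P (P *ᵥ e - e) ι n =
      P *ᵥ (history P (P *ᵥ e - e) ι n + e) - (history P (P *ᵥ e - e) ι n + e) := by
  induction n with
  | zero => simp [fluid, history]
  | succ n ih => rw [fluid, history, ih, diffOp_mulVec_residual, add_right_comm]

lemma testedFluid_eq (e : Fin N → ℝ) (ι : ℕ → Fin N) (n : ℕ) :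
    testedFluid P (P *ᵥ e - e) ι n =
      P *ᵥ (testedHistory P (P *ᵥ e - e) ι n + e) - (testedHistory P (P *ᵥ e - e) ι n + e) := by
  induction n with
  | zero => simp [testedFluid, testedHistory]
  | succ n ih =>
    rw [testedFluid, testedHistory]
    split_ifs with h
    · rw [ih, diffOp_mulVec_residual, add_right_comm]
    · exact ih

lemma frequently_of_infinite {ι : ℕ → Fin N} {i : Fin N} (h : {n | ι n = i}.Infinite) :
    ∃ᶠ n in atTop, ι n = i :=
  Nat.frequently_atTop_iff_infinite.2 h

lemma tendsto_history (hP : ∀ i j, 0 ≤ P i j) (hV : ∀ i, 0 < V i) (hVP : V ᵥ* P = V)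
    {e : Fin N → ℝ} (he : 0 ≤ e) {ι : ℕ → Fin N} (hι : IsNegFair P (P *ᵥ e - e) ι) :
    ∃ L, Tendsto (fun n => history P (P *ᵥ e - e) ι n + e) atTop (𝓝 L) ∧
      IsGreatest {Y | P *ᵥ Y = Y ∧ Y ≤ e} L := by
  have hF := fluid_eq (P := P) e ι
  set H := history P (P *ᵥ e - e) ι
  have hstep : ∀ n i, H (n + 1) i = if ι n = i then (P *ᵥ (H n + e)) i - e i else H n i := by
    intro n i
    have hs : H (n + 1) = H n + projMat (ι n) *ᵥ fluid P (P *ᵥ e - e) ι n := rfl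
    rw [hs, hF n, projMat_mulVec]
    split_ifs with h
    · subst h
      simp only [Pi.add_apply, Pi.single_eq_same, Pi.sub_apply]
      ring
    · simp [Ne.symm h]
  have hneg : ∀ n, (P *ᵥ (H n + e)) (ι n) ≤ H n (ι n) + e (ι n) := fun n => by
    have := hι.1 n
    rw [hF n] at this
    simpa using this
  have h0 : H 0 + e = e := by simp [H, history]
  have := tendsto_of_relaxation hP hV hVP (X := fun n => H n + e) (by simpa [h0] using he) ?_ ?_ ?_
  · simpa [h0] using this
  · intro n i
    simp only [Pi.add_apply, hstep]
    split_ifs with h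
    · subst h; linarith [hneg n]
    · exact le_rfl
  · intro n i
    simp only [Pi.add_apply, Pi.inf_apply, hstep]
    split_ifs with h
    · simp
    · exact inf_le_left
  · intro i
    by_cases hi : ∃ n, fluid P (P *ᵥ e - e) ι n i < 0
    · refine (frequently_of_infinite (hι.2 i hi)).mono fun n hn => ?_
      simp [hstep, hn]
    · -- The coordinate `i` decreases, and its fluid is never negative.
      push Not at hi
      refine Frequently.of_forall fun n => ?_
      have h1 := hi n
      rw [hF n] at h1
      simp only [Pi.sub_apply, Pi.add_apply] at h1
      simp only [Pi.add_apply, hstep]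
      split_ifs with h <;> linarith

lemma tendsto_testedHistory (hP : ∀ i j, 0 ≤ P i j) (hV : ∀ i, 0 < V i) (hVP : V ᵥ* P = V)
    {e : Fin N → ℝ} (he : 0 ≤ e) {ι : ℕ → Fin N} (hι : IsFair ι) :
    ∃ L, Tendsto (fun n => testedHistory P (P *ᵥ e - e) ι n + e) atTop (𝓝 L) ∧
      IsGreatest {Y | P *ᵥ Y = Y ∧ Y ≤ e} L := by
  have hF := testedFluid_eq (P := P) e ι
  set H := testedHistory P (P *ᵥ e - e) ι
  have hstep : ∀ n i, H (n + 1) i + e i =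
      if ι n = i then min (H n i + e i) ((P *ᵥ (H n + e)) i) else H n i + e i := by
    intro n i
    have hs : H (n + 1) = if testedFluid P (P *ᵥ e - e) ι n (ι n) < 0 then
        H n + projMat (ι n) *ᵥ testedFluid P (P *ᵥ e - e) ι n else H n := rfl
    rw [hs, hF n, projMat_mulVec]
    by_cases h : ι n = i
    · subst h
      rw [if_pos rfl]
      split_ifs with hlt
      · rw [min_eq_right (le_of_lt (by simpa using hlt))]
        simp only [Pi.add_apply, Pi.single_eq_same, Pi.sub_apply]
        ring
      · rw [min_eq_left (by simpa using hlt)]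
    · split_ifs <;> simp [Ne.symm h]
  have h0 : H 0 + e = e := by simp [H, testedHistory]
  have := tendsto_of_relaxation hP hV hVP (X := fun n => H n + e) (by simpa [h0] using he) ?_ ?_ ?_
  · simpa [h0] using this
  · intro n i
    simp only [Pi.add_apply, hstep]
    split_ifs with h
    · exact min_le_left _ _
    · exact le_rfl
  · intro n i
    simp only [Pi.add_apply, Pi.inf_apply, hstep]
    split_ifs with h
    · exact le_rfl
    · exact inf_le_left
  · intro i
    refine (frequently_of_infinite (hι i)).mono fun n hn => ?_
    simp [hstep, hn]

lemma exists_isFair (hN : 0 < N) : ∃ ι : ℕ → Fin N, IsFair ι := by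
  refine ⟨fun n => ⟨n % N, Nat.mod_lt n hN⟩, fun i => ?_⟩
  refine Set.infinite_of_injective_forall_mem (f := fun k : ℕ => N * k + i) (fun a b h => ?_)
    fun k => ?_
  · simpa [hN.ne'] using h
  · simp [Fin.ext_iff, Nat.mod_eq_of_lt i.2]

end Iteration

end DIter

theorem mainTheorem2 (N : ℕ) (hN : 0 < N) (P : Matrix (Fin N) (Fin N) ℝ)
    (hP : ∀ i j, 0 ≤ P i j)
    (V : Fin N → ℝ) (hV : ∀ i, 0 < V i) (hVP : Matrix.vecMul V P = V) :
    ∃ Hlim : Fin N → ℝ,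
      (∀ ι : ℕ → Fin N,
        DIter.IsNegFair P (P.mulVec (DIter.unitVec N) - DIter.unitVec N) ι →
          Tendsto (DIter.history P (P.mulVec (DIter.unitVec N) - DIter.unitVec N) ι)
            atTop (𝓝 Hlim)) ∧
      (∀ ι : ℕ → Fin N, DIter.IsFair ι →
          Tendsto (DIter.testedHistory P (P.mulVec (DIter.unitVec N) - DIter.unitVec N) ι)
            atTop (𝓝 Hlim)) ∧
      DIter.IsNormalizedEigenvector P (Hlim + DIter.unitVec N) ∧
      (∀ X : Fin N → ℝ, DIter.IsNormalizedEigenvector P X → X = Hlim + DIter.unitVec N) := by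
  have he : 0 ≤ DIter.unitVec N := fun i => by simp [DIter.unitVec]
  obtain ⟨ι₀, hι₀⟩ := DIter.exists_isFair hN
  obtain ⟨L, -, hL⟩ := DIter.tendsto_testedHistory hP hV hVP he hι₀
  have hnorm := DIter.isNormalizedEigenvector_of_isGreatest hN hP hV hVP hL
  refine ⟨L - DIter.unitVec N, fun ι hι => ?_, fun ι hι => ?_, ?_, fun X hX => ?_⟩
  · obtain ⟨L', hlim, hL'⟩ := DIter.tendsto_history hP hV hVP he hι
    rw [hL'.unique hL] at hlim
    simpa using hlim.sub_const (DIter.unitVec N)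
  · obtain ⟨L', hlim, hL'⟩ := DIter.tendsto_testedHistory hP hV hVP he hι
    rw [hL'.unique hL] at hlim
    simpa using hlim.sub_const (DIter.unitVec N)
  · rwa [sub_add_cancel]
  · rw [sub_add_cancel]
    exact le_antisymm (hX.le hP hV hVP hnorm) (hnorm.le hP hV hVP hX)
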